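/- A (feedforward ReLU) neural network on $\mathbb{R}^n$ is a function $F:\mathbb{R}^n\to\mathbb{R}$ given by finitely many (possibly zero) hidden layers $X_l=\mathrm{ReLU}(W_lX_{l-1}+b_l)\in\mathbb{R}^{n_l}$, $X_0=x$, followed by an affine output layer; its width is $\max_l n_l$ over the hidden layers ($0$ if there are none). A dataset in dimension $n$ is a finite set $S\subset[0,1]^n\times\{-1,1\}$ in which no point occurs with both labels. A memorization algorithm $\mathcal{L}$ assigns to every $n\ge 1$ and every dataset $S$ in dimension $n$ a network $\mathcal{L}(S)$ on $\mathbb{R}^n$ with $\mathrm{sign}(\mathcal{L}(S)(x))=y$ for all $(x,y)\in S$. For $c>0$, $\mathcal{D}(n,c)$ is the set of probability distributions $\mathcal{D}$ on $[0,1]^n\times\{-1,1\}$ such that $\|x-z\|_2\ge c$ whenever $(x,1)$ and $(z,-1)$ are in the support of $\mathcal{D}$. The accuracy of a network $F$ is $A_{\mathcal{D}}(F)=\Pr_{(x,y)\sim\mathcal{D}}(\mathrm{sign}(F(x))=y)$, where $\mathrm{sign}(0)=0$. **Theorem (fixed width precludes generalization).** Let $w\ge 1$ be an integer and let $\mathcal{L}$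 be a memorization algorithm such that $\mathcal{L}(S)$ has width at most $w$ for every dataset $S$ in every dimension $n\ge 1$. Then there exist an integer $n>w$, a real number $c>0$ and a distribution $\mathcal{D}\in\mathcal{D}(n,c)$ such that, for every $N$ and every sample $\mathcal{D}_{tr}$ in the support of $\mathcal{D}^N$ (regarded as the set of its entries), $$A_{\mathcal{D}}(\mathcal{L}(\mathcal{D}_{tr}))\le 0.51 .$$ Moreover, $\mathcal{D}$ can be chosen of the following form: for some $q\in\mathbb{R}^n$ and $0<r_1<r_2<r_3$, it is the uniform distribution on the ball $\{\|x-q\|_2\le r_1\}$, whose points have label $1$, together with the shell $\{r_2<\|x-q\|_2\le r_3\}$, whose points have label $-1$, with the same constant density on both. -/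

import Mathlib

open MeasureTheory

noncomputable section

/-- A fully connected feedforward ReLU network with input dimension `n` and real output:
some number (possibly zero) of hidden layers `X ↦ ReLU (W X + b)`, followed by an affine
output layer. -/
inductive Network : ℕ → Type
  | output {n : ℕ} (W : Fin n → ℝ) (b : ℝ) : Network n
  | hidden {n k : ℕ} (W : Matrix (Fin k) (Fin n) ℝ) (b : Fin k → ℝ) (rest : Network k) :
      Network n

namespace Network

/-- The function computed by a network. -/
def eval : {n : ℕ} → Network n → (Fin n → ℝ) → ℝ
  | _, output W b, x => W ⬝ᵥ x + b
  | _, hidden W b rest, x => rest.eval (fun i => max ((W.mulVec x + b) i) 0)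

/-- The width: the maximal number of nodes in a hidden layer (`0` if there is none). -/
def width : {n : ℕ} → Network n → ℕ
  | _, output _ _ => 0
  | _, @hidden _ k _ _ rest => max k rest.width

end Network

/-- Labelled points: a point of Euclidean space `ℝⁿ` with a real label. -/
abbrev Labelled (n : ℕ) : Type := EuclideanSpace ℝ (Fin n) × ℝ

/-- The data space `[0,1]ⁿ × {-1,1}`. -/
def dataSpace (n : ℕ) : Set (Labelled n) :=
  {p | (∀ i, p.1 i ∈ Set.Icc (0 : ℝ) 1) ∧ (p.2 = -1 ∨ p.2 = 1)}

/-- A (finite) dataset: a finite subset of `[0,1]ⁿ × {-1,1}` in which no point carries two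
different labels. -/
def IsDataset {n : ℕ} (S : Finset (Labelled n)) : Prop :=
  (∀ p ∈ S, p ∈ dataSpace n) ∧ ∀ p ∈ S, ∀ q ∈ S, p.1 = q.1 → p.2 = q.2

/-- The network gives the right label to the labelled point `p`. -/
def Network.Correct {n : ℕ} (F : Network n) (p : Labelled n) : Prop :=
  Real.sign (F.eval p.1.ofLp) = p.2

/-- The network memorizes the finite set `S`. -/
def Network.Memorizes {n : ℕ} (F : Network n) (S : Finset (Labelled n)) : Prop :=
  ∀ p ∈ S, F.Correct p

/-- A memorization algorithm maps each dataset in each positive dimension to a network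
memorizing it. The values on finite sets that are not datasets are irrelevant. -/
def IsMemorizationAlgorithm (L : (n : ℕ) → Finset (Labelled n) → Network n) : Prop :=
  ∀ n : ℕ, 0 < n → ∀ S : Finset (Labelled n), IsDataset S → (L n S).Memorizes S

/-- The probability distributions on `[0,1]ⁿ × {-1,1}` for which points with label `1` and
points with label `-1` have Euclidean distance at least `c`. -/
def separatedDistributions (n : ℕ) (c : ℝ) : Set (Measure (Labelled n)) :=
  {D | IsProbabilityMeasure D ∧ (∀ᵐ p ∂D, p ∈ dataSpace n) ∧
    ∀ p ∈ D.support, ∀ q ∈ D.support, p.2 = 1 → q.2 = -1 → c ≤ ‖p.1 - q.1‖}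

/-- The accuracy of a network on a distribution. -/
def accuracy {n : ℕ} (D : Measure (Labelled n)) (F : Network n) : ℝ :=
  D.real {p | F.Correct p}

/-- The uniform distribution on the union of the ball of radius `r₁` around `q`, labelled `1`,
and the shell of radii `r₂` and `r₃` around `q`, labelled `-1`. -/
def ballShell {n : ℕ} (q : EuclideanSpace ℝ (Fin n)) (r₁ r₂ r₃ : ℝ) : Measure (Labelled n) :=
  (volume (Metric.closedBall q r₁) +
      volume (Metric.closedBall q r₃ \ Metric.closedBall q r₂))⁻¹ •
    ((volume.restrict (Metric.closedBall q r₁)).map (fun x => (x, (1 : ℝ))) +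
      (volume.restrict (Metric.closedBall q r₃ \ Metric.closedBall q r₂)).map
        (fun x => (x, (-1 : ℝ))))

open Classical in
/-- The finite set of values of a sample. -/
def sampleSet {n N : ℕ} (s : Fin N → Labelled n) : Finset (Labelled n) :=
  Finset.univ.image s

end

/-!
A network `F` of width at most `w` depends on its input only through a linear map into at most
`max 1 w` dimensions, so it is invariant under translation by a subspace `K` of dimension at least
`d = n - max 1 w`. Dilating the ball `B(q, r₂)` along `K` into `B(q, r₃)` multiplies the volume of
the region `A = {F > 0}` inside it by at least `(r₃ / r₂) ^ d`. If `2 r₂ ^ d ≤ r₃ ^ d`, the shell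
therefore contains at least as much of `A`, all of it misclassified, as the ball
`B(q, r₁) ⊆ B(q, r₂)` does, and the network cannot beat the constant answer `-1`. That answer has
accuracy close to `1 / 2`: as `d → ∞` with `(r₃ / r₂) ^ d = 2`, also `(r₃ / r₂) ^ n → 2`, so the
shell has asymptotically the volume of `B(q, r₂)`, and `r₁` can be taken as close to `r₂` as we
like.
-/

namespace Network

theorem continuous_eval : ∀ {n : ℕ} (F : Network n), Continuous F.eval
  | _, output _ _ => (continuous_const.dotProduct continuous_id).add continuous_const
  | _, hidden W b rest => by
    have hlayer : Continuous fun x => W.mulVec x + b :=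
      (continuous_const.matrix_mulVec continuous_id).add continuous_const
    exact rest.continuous_eval.comp <|
      continuous_pi fun i => ((continuous_apply i).comp hlayer).max continuous_const

theorem exists_matrix_eval_eq {n : ℕ} (F : Network n) :
    ∃ k ≤ max 1 F.width, ∃ W : Matrix (Fin k) (Fin n) ℝ,
      ∀ x y, W.mulVec x = W.mulVec y → F.eval x = F.eval y := by
  cases F with
  | output W b =>
    refine ⟨1, le_max_left _ _, fun _ => W, fun x y h => ?_⟩
    have hdot : W ⬝ᵥ x = W ⬝ᵥ y := congrFun h 0
    simp only [eval, hdot]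
  | @hidden _ k W b rest =>
    refine ⟨k, le_max_of_le_right (le_max_left _ _), W, fun x y h => ?_⟩
    simp only [eval, h]

theorem exists_submodule_eval_add_eq {n : ℕ} (F : Network n) :
    ∃ K : Submodule ℝ (EuclideanSpace ℝ (Fin n)), n ≤ max 1 F.width + Module.finrank ℝ K ∧
      ∀ x, ∀ v ∈ K, F.eval (x + v).ofLp = F.eval x.ofLp := by
  obtain ⟨k, hk, W, hW⟩ := F.exists_matrix_eval_eq
  refine ⟨W.toEuclideanLin.ker, ?_, fun x v hv => hW _ _ ?_⟩
  · have hrank := W.toEuclideanLin.finrank_range_add_finrank_ker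
    have hrange := W.toEuclideanLin.range.finrank_le
    rw [finrank_euclideanSpace_fin] at hrank hrange
    omega
  · have hv' : W.mulVec v.ofLp = 0 := congrArg WithLp.ofLp (LinearMap.mem_ker.1 hv)
    rw [WithLp.ofLp_add, Matrix.mulVec_add, hv', add_zero]

theorem correct_one_iff {n : ℕ} (F : Network n) (x : EuclideanSpace ℝ (Fin n)) :
    F.Correct (x, 1) ↔ 0 < F.eval x.ofLp := by
  rcases lt_trichotomy (F.eval x.ofLp) 0 with h | h | h
  · norm_num [Correct, Real.sign_of_neg h, h.le]
  · norm_num [Correct, h]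
  · simp only [Correct, Real.sign_of_pos h, h]

theorem correct_neg_one_iff {n : ℕ} (F : Network n) (x : EuclideanSpace ℝ (Fin n)) :
    F.Correct (x, -1) ↔ F.eval x.ofLp < 0 := by
  rcases lt_trichotomy (F.eval x.ofLp) 0 with h | h | h
  · simp only [Correct, Real.sign_of_neg h, h]
  · norm_num [Correct, h]
  · norm_num [Correct, Real.sign_of_pos h, h.le]

end Network

section Dilation

variable {E : Type*} [NormedAddCommGroup E] [InnerProductSpace ℝ E]

/-- The dilation by the factor `t` along the subspace `K`, fixing the orthogonal complement. -/
noncomputable def dilationAlong (K : Submodule ℝ E) [K.HasOrthogonalProjection] (t : ℝ) :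
    E →ₗ[ℝ] E :=
  LinearMap.id + (t - 1) • K.starProjection.toLinearMap

section

variable (K : Submodule ℝ E) [K.HasOrthogonalProjection]

theorem dilationAlong_apply (t : ℝ) (x : E) :
    dilationAlong K t x = x + (t - 1) • K.starProjection x := rfl

theorem dilationAlong_sub_self_mem (t : ℝ) (x : E) : dilationAlong K t x - x ∈ K := by
  rw [dilationAlong_apply, add_sub_cancel_left]
  exact K.smul_mem _ (K.starProjection_apply_mem x)

theorem norm_dilationAlong_le {t : ℝ} (ht : 1 ≤ t) (x : E) :
    ‖dilationAlong K t x‖ ≤ t * ‖x‖ :=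
  calc ‖x + (t - 1) • K.starProjection x‖ ≤ ‖x‖ + ‖(t - 1) • K.starProjection x‖ :=
        norm_add_le _ _
    _ = ‖x‖ + (t - 1) * ‖K.starProjection x‖ := by
        rw [norm_smul, Real.norm_of_nonneg (sub_nonneg.2 ht)]
    _ ≤ ‖x‖ + (t - 1) * ‖x‖ := by
        gcongr
        exact K.norm_starProjection_apply_le x
    _ = t * ‖x‖ := by ring

theorem det_dilationAlong [FiniteDimensional ℝ E] (t : ℝ) :
    (dilationAlong K t).det = t ^ Module.finrank ℝ K := by
  have hmem : K ≤ K.comap (dilationAlong K t) := fun x hx => by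
    simpa using K.add_mem (dilationAlong_sub_self_mem K t x) hx
  have hrestrict : (dilationAlong K t).restrict hmem = t • LinearMap.id := by
    ext x
    simp [dilationAlong_apply, K.starProjection_eq_self_iff.2 x.2, sub_smul]
  have hquotient : K.mapQ K (dilationAlong K t) hmem = LinearMap.id := by
    ext x
    exact (Submodule.Quotient.eq K).2 (dilationAlong_sub_self_mem K t x)
  rw [LinearMap.det_eq_det_mul_det K _ hmem, hrestrict, hquotient]
  simp

end

variable [FiniteDimensional ℝ E] [MeasurableSpace E] [BorelSpace E] (μ : Measure E)
  [μ.IsAddHaarMeasure] (K : Submodule ℝ E) {A : Set E}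

theorem pow_finrank_mul_measure_closedBall_inter_le (hA : ∀ x ∈ A, ∀ v ∈ K, x + v ∈ A)
    {t : ℝ} (ht : 1 ≤ t) (q : E) (r : ℝ) :
    ENNReal.ofReal (t ^ Module.finrank ℝ K) * μ (Metric.closedBall q r ∩ A) ≤
      μ (Metric.closedBall q (t * r) ∩ A) := by
  have himage : dilationAlong K t '' ((· + q) ⁻¹' (Metric.closedBall q r ∩ A)) ⊆
      (· + q) ⁻¹' (Metric.closedBall q (t * r) ∩ A) := by
    rintro _ ⟨x, ⟨hx, hxA⟩, rfl⟩
    constructor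
    · simp only [Metric.mem_closedBall, dist_eq_norm, add_sub_cancel_right] at hx ⊢
      exact (norm_dilationAlong_le K ht x).trans (by gcongr)
    · have hmem := hA _ hxA _ (dilationAlong_sub_self_mem K t x)
      rwa [show x + q + (dilationAlong K t x - x) = dilationAlong K t x + q by abel] at hmem
  have hle := measure_mono (μ := μ) himage
  rwa [Measure.addHaar_image_linearMap, measure_preimage_add_right, measure_preimage_add_right,
    det_dilationAlong, abs_of_nonneg (by positivity)] at hle

theorem measure_closedBall_inter_le_measure_shell_inter (hA : ∀ x ∈ A, ∀ v ∈ K, x + v ∈ A)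
    {r₁ r₂ r₃ : ℝ} (h₂ : 0 < r₂) (h₁₂ : r₁ ≤ r₂) (h₂₃ : r₂ ≤ r₃) {d : ℕ}
    (hd : d ≤ Module.finrank ℝ K) (hr : 2 * r₂ ^ d ≤ r₃ ^ d) (q : E) :
    μ (Metric.closedBall q r₁ ∩ A) ≤
      μ ((Metric.closedBall q r₃ \ Metric.closedBall q r₂) ∩ A) := by
  have ht : 1 ≤ r₃ / r₂ := (one_le_div h₂).2 h₂₃
  have hpow : 2 ≤ (r₃ / r₂) ^ Module.finrank ℝ K :=
    calc 2 ≤ (r₃ / r₂) ^ d := by rwa [div_pow, le_div_iff₀ (by positivity)]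
      _ ≤ (r₃ / r₂) ^ Module.finrank ℝ K := pow_le_pow_right₀ ht hd
  have hdouble : 2 * μ (Metric.closedBall q r₂ ∩ A) ≤ μ (Metric.closedBall q r₃ ∩ A) := by
    have hdil := pow_finrank_mul_measure_closedBall_inter_le μ K hA ht q r₂
    rw [div_mul_cancel₀ _ h₂.ne'] at hdil
    refine le_trans (mul_le_mul_left ?_ _) hdil
    simpa using ENNReal.ofReal_le_ofReal hpow
  have hsplit : μ (Metric.closedBall q r₃ ∩ A) ≤ μ (Metric.closedBall q r₂ ∩ A) +
      μ ((Metric.closedBall q r₃ \ Metric.closedBall q r₂) ∩ A) := by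
    refine (measure_mono fun x hx => ?_).trans (measure_union_le _ _)
    by_cases hx₂ : x ∈ Metric.closedBall q r₂
    exacts [Or.inl ⟨hx₂, hx.2⟩, Or.inr ⟨⟨hx.1, hx₂⟩, hx.2⟩]
  have hfin : μ (Metric.closedBall q r₂ ∩ A) ≠ ⊤ :=
    measure_ne_top_of_subset Set.inter_subset_left measure_closedBall_lt_top.ne
  calc μ (Metric.closedBall q r₁ ∩ A) ≤ μ (Metric.closedBall q r₂ ∩ A) := by gcongr
    _ ≤ μ ((Metric.closedBall q r₃ \ Metric.closedBall q r₂) ∩ A) :=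
        (ENNReal.add_le_add_iff_left hfin).1 <| two_mul (μ (_ ∩ A)) ▸ hdouble.trans hsplit

end Dilation

theorem isClosed_dataSpace (n : ℕ) : IsClosed (dataSpace n) := by
  simp only [dataSpace, Set.mem_Icc, Set.ofPred_and, Set.ofPred_or, Set.ofPred_forall]
  refine (isClosed_iInter fun i => (isClosed_le ?_ ?_).inter (isClosed_le ?_ ?_)).inter
    ((isClosed_eq ?_ ?_).union (isClosed_eq ?_ ?_)) <;> fun_prop

theorem apply_mem_support_of_mem_support_pi {ι : Type*} [Fintype ι] {X : ι → Type*}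
    [∀ i, TopologicalSpace (X i)] [∀ i, MeasurableSpace (X i)] [∀ i, OpensMeasurableSpace (X i)]
    {μ : ∀ i, Measure (X i)} [∀ i, IsProbabilityMeasure (μ i)] {s : ∀ i, X i}
    (hs : s ∈ (Measure.pi μ).support) (i : ι) : s i ∈ (μ i).support := by
  simp only [Measure.support_eq_forall_isOpen, Set.mem_ofPred_eq] at hs ⊢
  intro U hsU hU
  rw [← (measurePreserving_eval μ i).measure_preimage hU.measurableSet.nullMeasurableSet]
  exact hs _ hsU (hU.preimage (continuous_apply i))

theorem sampleSet_subset_support {n N : ℕ} {D : Measure (Labelled n)} [IsProbabilityMeasure D]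
    {s : Fin N → Labelled n} (hs : s ∈ (Measure.pi fun _ : Fin N => D).support) :
    ↑(sampleSet s) ⊆ D.support := by
  intro p hp
  obtain ⟨i, -, rfl⟩ := Finset.mem_image.1 hp
  exact apply_mem_support_of_mem_support_pi hs i

theorem isDataset_of_subset_support {n : ℕ} {c : ℝ} (hc : 0 < c) {D : Measure (Labelled n)}
    (hD : D ∈ separatedDistributions n c) {S : Finset (Labelled n)} (hS : ↑S ⊆ D.support) :
    IsDataset S := by
  obtain ⟨-, hdata, hsep⟩ := hD
  have hmem : ∀ p ∈ S, p ∈ dataSpace n := fun p hp =>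
    Measure.support_subset_of_isClosed (isClosed_dataSpace n) hdata (hS hp)
  have hne : ∀ p ∈ S, ∀ p' ∈ S, p.1 = p'.1 → p.2 = 1 → p'.2 ≠ -1 :=
    fun p hp p' hp' heq h h' => by
      have hle := hsep p (hS hp) p' (hS hp') h h'
      rw [heq, sub_self, norm_zero] at hle
      exact hc.not_ge hle
  refine ⟨hmem, fun p hp p' hp' heq => ?_⟩
  rcases (hmem p hp).2 with h | h <;> rcases (hmem p' hp').2 with h' | h'
  · rw [h, h']
  · exact absurd h (hne p' hp' p hp heq.symm h')
  · exact absurd h' (hne p hp p' hp' heq h)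
  · rw [h, h']

section BallShell

variable {n : ℕ} (q : EuclideanSpace ℝ (Fin n)) {r₁ r₂ r₃ : ℝ}

theorem ballShell_real_apply (s : Set (Labelled n)) :
    (ballShell q r₁ r₂ r₃).real s =
      (volume.real (Metric.closedBall q r₁ ∩ {x | (x, (1 : ℝ)) ∈ s}) +
        volume.real ((Metric.closedBall q r₃ \ Metric.closedBall q r₂) ∩
          {x | (x, (-1 : ℝ)) ∈ s})) /
      (volume.real (Metric.closedBall q r₁) +
        volume.real (Metric.closedBall q r₃ \ Metric.closedBall q r₂)) := by
  have hmap (y : ℝ) {B : Set (EuclideanSpace ℝ (Fin n))} (hB : MeasurableSet B) :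
      (volume.restrict B).map (fun x => (x, y)) s = volume (B ∩ {x | (x, y) ∈ s}) := by
    rw [(measurableEmbedding_prod_mk_right y).map_apply, Measure.restrict_apply' hB,
      Set.inter_comm]
    rfl
  have hball : volume (Metric.closedBall q r₁) ≠ ⊤ := measure_closedBall_lt_top.ne
  have hshell : volume (Metric.closedBall q r₃ \ Metric.closedBall q r₂) ≠ ⊤ :=
    measure_ne_top_of_subset Set.sdiff_subset measure_closedBall_lt_top.ne
  simp only [measureReal_def, ballShell, Measure.smul_apply, Measure.add_apply, smul_eq_mul,
    hmap _ measurableSet_closedBall,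
    hmap _ (measurableSet_closedBall.diff measurableSet_closedBall), ENNReal.toReal_mul,
    ENNReal.toReal_inv, ENNReal.toReal_add hball hshell,
    ENNReal.toReal_add (measure_ne_top_of_subset Set.inter_subset_left hball)
      (measure_ne_top_of_subset Set.inter_subset_left hshell), div_eq_inv_mul]

theorem isProbabilityMeasure_ballShell (h₁ : 0 < r₁) :
    IsProbabilityMeasure (ballShell q r₁ r₂ r₃) := by
  have hball : 0 < volume.real (Metric.closedBall q r₁) :=
    ENNReal.toReal_pos (Metric.measure_closedBall_pos volume q h₁).ne' measure_closedBall_lt_top.ne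
  rw [isProbabilityMeasure_iff_real, ballShell_real_apply]
  simp only [Set.mem_univ, Set.ofPred_true, Set.inter_univ]
  exact div_self (by positivity)

theorem ae_ballShell {P : Labelled n → Prop}
    (hball : ∀ x ∈ Metric.closedBall q r₁, P (x, 1))
    (hshell : ∀ x ∈ Metric.closedBall q r₃ \ Metric.closedBall q r₂, P (x, -1)) :
    ∀ᵐ p ∂ballShell q r₁ r₂ r₃, P p := by
  refine Measure.ae_smul_measure (ae_add_measure_iff.2 ⟨?_, ?_⟩) _
  · exact (measurableEmbedding_prod_mk_right _).ae_map_iff.2 <|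
      ae_restrict_of_forall_mem measurableSet_closedBall hball
  · exact (measurableEmbedding_prod_mk_right _).ae_map_iff.2 <|
      ae_restrict_of_forall_mem (measurableSet_closedBall.diff measurableSet_closedBall) hshell

theorem norm_sub_le_or_le_norm_sub_of_mem_support {p : Labelled n}
    (hp : p ∈ (ballShell q r₁ r₂ r₃).support) :
    (‖p.1 - q‖ ≤ r₁ ∧ p.2 = 1) ∨ (r₂ ≤ ‖p.1 - q‖ ∧ p.2 = -1) := by
  have hclosed : IsClosed {p : Labelled n |
      (‖p.1 - q‖ ≤ r₁ ∧ p.2 = 1) ∨ (r₂ ≤ ‖p.1 - q‖ ∧ p.2 = -1)} := by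
    have hnorm : Continuous fun p : Labelled n => ‖p.1 - q‖ := by fun_prop
    exact ((isClosed_le hnorm continuous_const).inter
      (isClosed_eq continuous_snd continuous_const)).union
      ((isClosed_le continuous_const hnorm).inter (isClosed_eq continuous_snd continuous_const))
  refine Measure.support_subset_of_isClosed hclosed
    (ae_ballShell q (fun x hx => Or.inl ⟨?_, rfl⟩) (fun x hx => Or.inr ⟨?_, rfl⟩)) hp
  · exact mem_closedBall_iff_norm.1 hx
  · exact (not_le.1 (mem_closedBall_iff_norm.not.1 hx.2)).le

theorem ballShell_mem_separatedDistributions (h₁ : 0 < r₁) (h₁₃ : r₁ ≤ r₃)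
    (hcube : ∀ x ∈ Metric.closedBall q r₃, ∀ i, x i ∈ Set.Icc (0 : ℝ) 1) :
    ballShell q r₁ r₂ r₃ ∈ separatedDistributions n (r₂ - r₁) := by
  refine ⟨isProbabilityMeasure_ballShell q h₁, ae_ballShell q
    (fun x hx => ⟨hcube x (Metric.closedBall_subset_closedBall h₁₃ hx), Or.inr rfl⟩)
    (fun x hx => ⟨hcube x hx.1, Or.inl rfl⟩), fun p hp p' hp' hlabel hlabel' => ?_⟩
  have hp₁ : ‖p.1 - q‖ ≤ r₁ :=
    (norm_sub_le_or_le_norm_sub_of_mem_support q hp).elim And.left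
      fun h => by norm_num [hlabel] at h
  have hp₂ : r₂ ≤ ‖p'.1 - q‖ :=
    (norm_sub_le_or_le_norm_sub_of_mem_support q hp').elim
      (fun h => by norm_num [hlabel'] at h) And.left
  have htriangle := norm_sub_le_norm_sub_add_norm_sub p'.1 p.1 q
  rw [norm_sub_rev p'.1 p.1] at htriangle
  linarith

theorem accuracy_ballShell (F : Network n) :
    accuracy (ballShell q r₁ r₂ r₃) F =
      (volume.real (Metric.closedBall q r₁ ∩ {x | 0 < F.eval x.ofLp}) +
        volume.real ((Metric.closedBall q r₃ \ Metric.closedBall q r₂) ∩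
          {x | F.eval x.ofLp < 0})) /
      (volume.real (Metric.closedBall q r₁) +
        volume.real (Metric.closedBall q r₃ \ Metric.closedBall q r₂)) := by
  simp only [accuracy, ballShell_real_apply, Set.mem_ofPred_eq, Network.correct_one_iff,
    Network.correct_neg_one_iff]

theorem volume_real_shell (h₂ : 0 ≤ r₂) (h₂₃ : r₂ ≤ r₃) :
    volume.real (Metric.closedBall q r₃ \ Metric.closedBall q r₂) =
      (r₃ ^ n - r₂ ^ n) * volume.real (Metric.ball (0 : EuclideanSpace ℝ (Fin n)) 1) := by
  rw [measureReal_sdiff (Metric.closedBall_subset_closedBall h₂₃) measurableSet_closedBall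
      measure_closedBall_lt_top.ne,
    Measure.addHaar_real_closedBall _ _ (h₂.trans h₂₃), Measure.addHaar_real_closedBall _ _ h₂,
    finrank_euclideanSpace_fin, sub_mul]

theorem accuracy_ballShell_le (h₁ : 0 < r₁) (h₁₂ : r₁ ≤ r₂) (h₂₃ : r₂ ≤ r₃) {d : ℕ}
    (hr : 2 * r₂ ^ d ≤ r₃ ^ d) (F : Network n) (hd : max 1 F.width + d ≤ n) :
    accuracy (ballShell q r₁ r₂ r₃) F ≤
      (r₃ ^ n - r₂ ^ n) / (r₁ ^ n + (r₃ ^ n - r₂ ^ n)) := by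
  set ball := Metric.closedBall q r₁
  set shell := Metric.closedBall q r₃ \ Metric.closedBall q r₂
  set pos := {x : EuclideanSpace ℝ (Fin n) | 0 < F.eval x.ofLp}
  set neg := {x : EuclideanSpace ℝ (Fin n) | F.eval x.ofLp < 0}
  have h₂ : 0 < r₂ := h₁.trans_le h₁₂
  have hshell : volume shell ≠ ⊤ :=
    measure_ne_top_of_subset Set.sdiff_subset measure_closedBall_lt_top.ne
  obtain ⟨K, hK, hinv⟩ := F.exists_submodule_eval_add_eq
  have hpos : volume.real (ball ∩ pos) ≤ volume.real (shell ∩ pos) :=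
    ENNReal.toReal_mono (measure_ne_top_of_subset Set.inter_subset_left hshell) <|
      measure_closedBall_inter_le_measure_shell_inter volume K
        (fun x hx v hv => (lt_of_lt_of_eq hx (hinv x v hv).symm :)) h₂ h₁₂ h₂₃ (by omega) hr q
  have hneg : volume.real (shell ∩ neg) ≤ volume.real (shell \ pos) :=
    measureReal_mono (fun x hx => ⟨hx.1, lt_asymm (show F.eval x.ofLp < 0 from hx.2)⟩)
      (measure_ne_top_of_subset Set.sdiff_subset hshell)
  have hsplit : volume.real (shell ∩ pos) + volume.real (shell \ pos) = volume.real shell :=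
    measureReal_inter_add_sdiff
      (measurableSet_lt measurable_const (F.continuous_eval.comp (by fun_prop)).measurable) hshell
  have hunit : volume.real (Metric.ball (0 : EuclideanSpace ℝ (Fin n)) 1) ≠ 0 :=
    (ENNReal.toReal_pos (Metric.measure_ball_pos volume _ one_pos).ne' measure_ball_lt_top.ne).ne'
  calc accuracy (ballShell q r₁ r₂ r₃) F
      ≤ volume.real shell / (volume.real ball + volume.real shell) := by
        rw [accuracy_ballShell]
        gcongr
        linarith
    _ = (r₃ ^ n - r₂ ^ n) / (r₁ ^ n + (r₃ ^ n - r₂ ^ n)) := by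
        rw [volume_real_shell q h₂.le h₂₃, Measure.addHaar_real_closedBall _ _ h₁.le,
          finrank_euclideanSpace_fin, ← add_mul, mul_div_mul_right _ _ hunit]

end BallShell

theorem apply_mem_Icc_of_mem_closedBall_half {ι : Type*} [Fintype ι] {x : EuclideanSpace ℝ ι}
    (hx : x ∈ Metric.closedBall (WithLp.toLp 2 fun _ => (1 / 2 : ℝ)) (1 / 2)) (i : ι) :
    x i ∈ Set.Icc (0 : ℝ) 1 := by
  have h := (PiLp.norm_apply_le _ i).trans (mem_closedBall_iff_norm.1 hx)
  simp only [PiLp.sub_apply, Real.norm_eq_abs, abs_le] at h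
  exact ⟨by linarith, by linarith⟩

section Radii

open Filter Topology

theorem exists_pow_eq_half_lt (k : ℕ) {a : ℝ} (ha : a < 1) :
    ∃ d : ℕ, 0 < d ∧ ∃ t : ℝ, 0 < t ∧ t < 1 ∧ t ^ d = 1 / 2 ∧ a < t ^ k := by
  have hlim : Tendsto (fun d : ℕ => ((1 / 2 : ℝ) ^ (d⁻¹ : ℝ)) ^ k) atTop (𝓝 1) := by
    have hexp : Tendsto (fun d : ℕ => (1 / 2 : ℝ) ^ (d⁻¹ : ℝ)) atTop (𝓝 ((1 / 2) ^ (0 : ℝ))) :=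
      tendsto_const_nhds.rpow tendsto_inv_atTop_nhds_zero_nat (Or.inl (by norm_num))
    simpa using hexp.pow k
  obtain ⟨d, had, hd⟩ := ((hlim.eventually_const_lt ha).and (eventually_gt_atTop 0)).exists
  exact ⟨d, hd, (1 / 2) ^ (d⁻¹ : ℝ), by positivity,
    Real.rpow_lt_one (by norm_num) (by norm_num) (by positivity),
    Real.rpow_inv_natCast_pow (by norm_num) hd.ne', had⟩

theorem exists_radii_shell_fraction_lt (k : ℕ) {R ε : ℝ} (hR : 0 < R) (hε : 0 < ε) :
    ∃ d : ℕ, 0 < d ∧ ∃ r₁ r₂ : ℝ, 0 < r₁ ∧ r₁ < r₂ ∧ r₂ < R ∧ 2 * r₂ ^ d = R ^ d ∧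
      (R ^ (k + d) - r₂ ^ (k + d)) / (r₁ ^ (k + d) + (R ^ (k + d) - r₂ ^ (k + d))) <
        1 / 2 + ε := by
  obtain ⟨d, hd, t, ht₀, ht₁, htd, htk⟩ := exists_pow_eq_half_lt k (a := 1 - 2 * ε) (by linarith)
  have hR' : R ^ (k + d) ≠ 0 := by positivity
  have hlim : Tendsto (fun r => (R ^ (k + d) - (t * R) ^ (k + d)) /
        (r ^ (k + d) + (R ^ (k + d) - (t * R) ^ (k + d)))) (𝓝[<] (t * R)) (𝓝 (1 - t ^ k / 2)) := by
    have hcont : ContinuousAt (fun r => (R ^ (k + d) - (t * R) ^ (k + d)) /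
        (r ^ (k + d) + (R ^ (k + d) - (t * R) ^ (k + d)))) (t * R) :=
      continuousAt_const.div (by fun_prop) (by simpa using hR')
    have hval : (R ^ (k + d) - (t * R) ^ (k + d)) /
        ((t * R) ^ (k + d) + (R ^ (k + d) - (t * R) ^ (k + d))) = 1 - t ^ k / 2 := by
      rw [add_sub_cancel, mul_pow, pow_add t, htd]
      field_simp
    exact hval ▸ hcont.tendsto.mono_left nhdsWithin_le_nhds
  have hlt : 1 - t ^ k / 2 < 1 / 2 + ε := by linarith
  obtain ⟨r₁, hfrac, h₁, h₁₂⟩ := ((hlim.eventually_lt_const hlt).and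
    (Ioo_mem_nhdsLT (by positivity))).exists
  refine ⟨d, hd, r₁, t * R, h₁, h₁₂, mul_lt_of_lt_one_left hR ht₁, ?_, hfrac⟩
  rw [mul_pow, htd]
  ring

end Radii

theorem mainTheorem4_general (w : ℕ) {ε : ℝ} (hε : 0 < ε) :
    ∃ n : ℕ, w < n ∧ ∃ c : ℝ, 0 < c ∧ ∃ D ∈ separatedDistributions n c,
      (∃ (q : EuclideanSpace ℝ (Fin n)) (r₁ r₂ r₃ : ℝ),
        0 < r₁ ∧ r₁ < r₂ ∧ r₂ < r₃ ∧ D = ballShell q r₁ r₂ r₃) ∧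
      ∀ F : Network n, F.width ≤ w → accuracy D F ≤ 1 / 2 + ε := by
  obtain ⟨d, hd, r₁, r₂, h₁, h₁₂, h₂₃, hr, hfrac⟩ :=
    exists_radii_shell_fraction_lt (max 1 w) (R := 1 / 2) (by norm_num) hε
  let q : EuclideanSpace ℝ (Fin (max 1 w + d)) := WithLp.toLp 2 fun _ => 1 / 2
  refine ⟨max 1 w + d, by omega, r₂ - r₁, sub_pos.2 h₁₂, ballShell q r₁ r₂ (1 / 2),
    ballShell_mem_separatedDistributions q h₁ (h₁₂.trans h₂₃).le
      fun x hx => apply_mem_Icc_of_mem_closedBall_half hx,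
    ⟨q, r₁, r₂, 1 / 2, h₁, h₁₂, h₂₃, rfl⟩, fun F hF => ?_⟩
  exact (accuracy_ballShell_le q h₁ h₁₂.le h₂₃.le hr.le F (by omega)).trans hfrac.le

theorem mainTheorem4 (w : ℕ) (hw : 0 < w)
    (L : (n : ℕ) → Finset (Labelled n) → Network n) (hL : IsMemorizationAlgorithm L)
    (hwidth : ∀ n : ℕ, 0 < n → ∀ S : Finset (Labelled n), IsDataset S → (L n S).width ≤ w) :
    ∃ n : ℕ, w < n ∧ ∃ c : ℝ, 0 < c ∧ ∃ D ∈ separatedDistributions n c,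
      (∃ (q : EuclideanSpace ℝ (Fin n)) (r₁ r₂ r₃ : ℝ),
        0 < r₁ ∧ r₁ < r₂ ∧ r₂ < r₃ ∧ D = ballShell q r₁ r₂ r₃) ∧
      ∀ (N : ℕ) (s : Fin N → Labelled n),
        s ∈ (Measure.pi fun _ : Fin N => D).support →
          accuracy D (L n (sampleSet s)) ≤ 0.51 := by
  obtain ⟨n, hwn, c, hc, D, hD, hform, hacc⟩ := mainTheorem4_general w (ε := 0.01) (by norm_num)
  have := hD.1
  refine ⟨n, hwn, c, hc, D, hD, hform, fun N s hs => ?_⟩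
  have hdata := isDataset_of_subset_support hc hD (sampleSet_subset_support hs)
  exact (hacc _ (hwidth n (by omega) _ hdata)).trans (by norm_num)
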